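/- Let $b$ be a prime, let $\alpha,\beta>1$, and let $\gamma^{(i)}=(\gamma^{(i)}_j)_{j\ge1}$, $i=1,2$, be non-increasing sequences of reals in $(0,1]$. For $k\in\mathbb N_0$ with base-$b$ digits $\kappa_0,\dots,\kappa_a$ (so $k=\sum_{j=0}^a\kappa_jb^j$) and $x=\sum_{i\ge1}\xi_ib^{-i}\in[0,1)$ (infinitely many digits $\xi_i\ne b-1$), let $\mathrm{wal}_k(x)=\exp\bigl(2\pi \mathrm i(\xi_1\kappa_0+\dots+\xi_{a+1}\kappa_a)/b\bigr)$. Put $\rho_{\alpha,\gamma}(0)=1$, $\rho_{\alpha,\gamma}(k)=\gamma b^{-\alpha\lfloor\log_bk\rfloor}$ for $k\ge 1$, and $r_{\beta,\gamma}(0)=1$, $r_{\beta,\gamma}(l)=\gamma|l|^{-\beta}$ for $l\in\mathbb Z\setminus\{0\}$. For $s,t\in\mathbb N=\{1,2,\dots\}$, $\boldsymbol k\in\mathbb N_0^s$, $\boldsymbol l\in\mathbb Z^t$ let $\rho(\boldsymbol k)=\prod_{j=1}^s\rho_{\alpha,\gamma^{(1)}_j}(k_j)$, $r(\boldsymbol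 l)=\prod_{j=1}^tr_{\beta,\gamma^{(2)}_j}(l_j)$, $e_{\boldsymbol k,\boldsymbol l}(\boldsymbol x,\boldsymbol y)=\prod_{j=1}^s\mathrm{wal}_{k_j}(x_j)\,\exp(2\pi\mathrm i\,\boldsymbol l\cdot\boldsymbol y)$, and $\widehat f(\boldsymbol k,\boldsymbol l)=\int_{[0,1)^{s+t}}f\,\overline{e_{\boldsymbol k,\boldsymbol l}}$. Let $\mathcal H_{s,t}$ be the Hilbert space of all $f:[0,1)^{s+t}\to\mathbb C$ that are pointwise equal to their absolutely convergent series $\sum_{\boldsymbol k,\boldsymbol l}\widehat f(\boldsymbol k,\boldsymbol l)e_{\boldsymbol k,\boldsymbol l}$ and satisfy $\|f\|^2=\sum_{\boldsymbol k,\boldsymbol l}\rho(\boldsymbol k)^{-1}r(\boldsymbol l)^{-1}|\widehat f(\boldsymbol k,\boldsymbol l)|^2<\infty$. Consider the problem $\mathrm{EMB}=(\mathrm{EMB}_{s,t})_{s,t\ge1}$ of approximating the embeddings $\mathrm{EMB}_{s,t}:\mathcal H_{s,t}\to L_2([0,1]^{s+t})$, $\mathrm{EMB}_{s,t}(f)=f$,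 with standard information $\Lambda^{\mathrm{std}}$, that is, by algorithms $A(f)=\sum_{k=1}^Na_kf(z_k)$ with $a_k\in L_2([0,1]^{s+t})$ and $z_k\in[0,1)^{s+t}$. Let $e(N,s,t)=\inf_A\sup_{\|f\|\le1}\|f-A(f)\|_{L_2}$, the infimum being over all such $A$, and let $N(\varepsilon,s,t)=\min\{N:e(N,s,t)\le\varepsilon\}$. The problem is called * weakly tractable if $\log N(\varepsilon,s,t)/(s+t+\varepsilon^{-1})\to0$ as $s+t+\varepsilon^{-1}\to\infty$, where $\varepsilon\in(0,1)$ and $s,t\in\mathbb N$; * polynomially tractable if there are $C,\tau_1,\tau_2\ge0$ with $N(\varepsilon,s,t)\le C\varepsilon^{-\tau_1}(s+t)^{\tau_2}$ for all $\varepsilon\in(0,1)$ and $s,t\in\mathbb N$; * strongly polynomially tractable if there are $C,\tau_1\ge0$ with $N(\varepsilon,s,t)\le C\varepsilon^{-\tau_1}$ for all $\varepsilon\in(0,1)$ and $s,t\in\mathbb N$; the infimum of all such $\tau_1$ is the $\varepsilon$-exponent. Let $s_{\gamma}=\inf\{\kappa>0:\sum_{j\ge1}(\gamma^{(1)}_j)^\kappa<\infty\text{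 and }\sum_{j\ge1}(\gamma^{(2)}_j)^\kappa<\infty\}$, with $\inf\emptyset=\infty$. Then, for the class $\Lambda^{\mathrm{std}}$: (a) If $\sum_{j=1}^\infty\gamma^{(1)}_j<\infty$ and $\sum_{j=1}^\infty\gamma^{(2)}_j<\infty$, then $\mathrm{EMB}$ is strongly polynomially tractable with $\varepsilon$-exponent at most $4+2\max(s_\gamma,\tfrac1\alpha,\tfrac1\beta)$. (b) If $\limsup_{s\to\infty}\sum_{j=1}^s\frac{\gamma^{(1)}_j}{\log(s+1)}<\infty$ and $\limsup_{t\to\infty}\sum_{j=1}^t\frac{\gamma^{(2)}_j}{\log(t+1)}<\infty$, then $\mathrm{EMB}$ is polynomially tractable. (c) If $\lim_{s+t\to\infty}\frac{\sum_{j=1}^s\gamma^{(1)}_j+\sum_{j=1}^t\gamma^{(2)}_j}{s+t}=0$, then $\mathrm{EMB}$ is weakly tractable. -/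

import Mathlib

open MeasureTheory Filter Topology
open scoped ENNReal NNReal

namespace HybridApprox

/-- The cube `[0,1)^(s+t)`, with a point written as a pair `(x, y)`, where `x` has `s` coordinates
and `y` has `t` coordinates. -/
abbrev Cube (s t : ℕ) : Type :=
  (Fin s → Set.Ico (0 : ℝ) 1) × (Fin t → Set.Ico (0 : ℝ) 1)

/-- Lebesgue measure on `[0,1)^(s+t)`: the product of the Lebesgue measures on the factors
`[0,1)`. -/
noncomputable def cubeMeasure (s t : ℕ) : Measure (Cube s t) :=
  (Measure.pi fun _ : Fin s => Measure.comap Subtype.val volume).prod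
    (Measure.pi fun _ : Fin t => Measure.comap Subtype.val volume)

/-- The index set `ℕ₀^s × ℤ^t` of the frequencies `(k, l)`. -/
abbrev Freq (s t : ℕ) : Type := (Fin s → ℕ) × (Fin t → ℤ)

/-! ### Walsh and trigonometric functions -/

/-- The `k`-th Walsh function in base `b`. The digit `κ_j` of `k` is `k / b ^ j % b`, the number of
digits of `k ≠ 0` is `Nat.log b k + 1`, and the digit `ξ_(j+1)` of `x ∈ [0,1)`, in the expansion
with infinitely many digits different from `b - 1`, is `⌊b ^ (j + 1) * x⌋ mod b`. -/
noncomputable def wal (b k : ℕ) (x : ℝ) : ℂ :=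
  Complex.exp (2 * Real.pi * Complex.I *
    (((∑ j ∈ Finset.range (Nat.log b k + 1),
      (⌊(b : ℝ) ^ (j + 1) * x⌋₊ % b) * (k / b ^ j % b) : ℕ) : ℂ) / (b : ℂ)))

/-- The product `wal_k(x) * e_l(y)` of the `s`-variate Walsh function and the `t`-variate
trigonometric function `e_l(y) = exp(2 π i l·y)`. -/
noncomputable def basisFun (b : ℕ) {s t : ℕ} (h : Freq s t) (z : Cube s t) : ℂ :=
  (∏ j, wal b (h.1 j) (z.1 j : ℝ)) *
    Complex.exp (2 * Real.pi * Complex.I * ((∑ j, (h.2 j : ℝ) * (z.2 j : ℝ) : ℝ) : ℂ))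

/-! ### The decay functions -/

/-- One-dimensional decay function of the Walsh part; `Nat.log b k = ⌊log_b k⌋`. -/
noncomputable def rho (b : ℕ) (α γ : ℝ) (k : ℕ) : ℝ :=
  if k = 0 then 1 else γ * (b : ℝ) ^ (-(α * (Nat.log b k : ℝ)))

/-- One-dimensional decay function of the Korobov part. -/
noncomputable def rKor (β γ : ℝ) (l : ℤ) : ℝ :=
  if l = 0 then 1 else γ * |(l : ℝ)| ^ (-β)

/-- The product `ρ_{α,γ⁽¹⁾}(k) * r_{β,γ⁽²⁾}(l)`. The sequences of weights are indexed from `0`: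
`γ₁ j` is the weight of the `(j+1)`-st coordinate. -/
noncomputable def decay (b : ℕ) (α β : ℝ) (γ₁ γ₂ : ℕ → ℝ) {s t : ℕ} (h : Freq s t) : ℝ :=
  (∏ j : Fin s, rho b α (γ₁ j) (h.1 j)) * ∏ j : Fin t, rKor β (γ₂ j) (h.2 j)

/-! ### The hybrid space -/

/-- The Walsh-Fourier coefficient `f̂(k, l)`. -/
noncomputable def coeff (b : ℕ) {s t : ℕ} (f : Cube s t → ℂ) (h : Freq s t) : ℂ :=
  ∫ z, f z * (starRingEnd ℂ) (basisFun b h z) ∂(cubeMeasure s t)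

/-- The hybrid space: all functions `f` on `[0,1)^(s+t)` that are everywhere equal to their
absolutely convergent series `∑ f̂(k,l) wal_k(x) e_l(y)` and have finite norm
(summability in `ℂ` is absolute summability). -/
def hybridSpace (b : ℕ) (α β : ℝ) (γ₁ γ₂ : ℕ → ℝ) (s t : ℕ) : Set (Cube s t → ℂ) :=
  {f | Integrable f (cubeMeasure s t) ∧
    (∀ z, HasSum (fun h : Freq s t => coeff b f h * basisFun b h z) (f z)) ∧
    Summable (fun h : Freq s t => (decay b α β γ₁ γ₂ h)⁻¹ * ‖coeff b f h‖ ^ 2)}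

/-- The norm of the hybrid space,
`‖f‖² = ⟨f, f⟩ = ∑ ρ(k)⁻¹ r(l)⁻¹ |f̂(k,l)|²`. -/
noncomputable def hybridNorm (b : ℕ) (α β : ℝ) (γ₁ γ₂ : ℕ → ℝ) {s t : ℕ}
    (f : Cube s t → ℂ) : ℝ :=
  Real.sqrt (∑' h : Freq s t, (decay b α β γ₁ γ₂ h)⁻¹ * ‖coeff b f h‖ ^ 2)

/-! ### Linear algorithms using standard information -/

/-- A linear algorithm that uses `N` function values: sample points `x_k` in the cube and
coefficients `a_k` in `L₂`. -/
structure StdAlgorithm (N s t : ℕ) where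
  point : Fin N → Cube s t
  weight : Fin N → Cube s t → ℂ
  memLp_weight : ∀ k, MemLp (weight k) 2 (cubeMeasure s t)

/-- The output `A(f) = ∑ a_k f(x_k)`. -/
noncomputable def StdAlgorithm.app {N s t : ℕ} (A : StdAlgorithm N s t) (f : Cube s t → ℂ) :
    Cube s t → ℂ :=
  fun z => ∑ k, A.weight k z * f (A.point k)

/-- The worst-case error `sup ‖f - A(f)‖_{L₂}` over the unit ball of the hybrid space. -/
noncomputable def worstCaseError (b : ℕ) (α β : ℝ) (γ₁ γ₂ : ℕ → ℝ) {N s t : ℕ}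
    (A : StdAlgorithm N s t) : ℝ≥0∞ :=
  ⨆ f ∈ {f ∈ hybridSpace b α β γ₁ γ₂ s t | hybridNorm b α β γ₁ γ₂ f ≤ 1},
    eLpNorm (fun z => f z - A.app f z) 2 (cubeMeasure s t)

/-- The `N`-th minimal worst-case error for standard information. -/
noncomputable def minimalError (b : ℕ) (α β : ℝ) (γ₁ γ₂ : ℕ → ℝ) (N s t : ℕ) : ℝ≥0∞ :=
  ⨅ A : StdAlgorithm N s t, worstCaseError b α β γ₁ γ₂ A

/-- The information complexity `min {N : e(N,s,t) ≤ ε}` for standard information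
(`⊤` if there is no such `N`). -/
noncomputable def infoComplexity (b : ℕ) (α β : ℝ) (γ₁ γ₂ : ℕ → ℝ) (ε : ℝ) (s t : ℕ) : ℕ∞ :=
  ⨅ (N : ℕ) (_ : minimalError b α β γ₁ γ₂ N s t ≤ ENNReal.ofReal ε), (N : ℕ∞)

/-! ### Tractability -/

/-- Weak tractability: the information complexity is always finite, and
`log N(ε,s,t) / (s + t + ε⁻¹)` tends to `0` as `s + t + ε⁻¹ → ∞`,
where `s, t ≥ 1` and `ε ∈ (0,1)`. -/
def WeaklyTractable (b : ℕ) (α β : ℝ) (γ₁ γ₂ : ℕ → ℝ) : Prop :=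
  (∀ s t : ℕ, 1 ≤ s → 1 ≤ t → ∀ ε : ℝ, 0 < ε → ε < 1 →
    infoComplexity b α β γ₁ γ₂ ε s t ≠ ⊤) ∧
  Tendsto
    (fun p : ℕ × ℕ × ℝ =>
      Real.log ((infoComplexity b α β γ₁ γ₂ p.2.2 p.1 p.2.1).toNat : ℝ) /
        ((p.1 : ℝ) + (p.2.1 : ℝ) + p.2.2⁻¹))
    (comap (fun p : ℕ × ℕ × ℝ => (p.1 : ℝ) + (p.2.1 : ℝ) + p.2.2⁻¹) atTop ⊓
      𝓟 {p | 1 ≤ p.1 ∧ 1 ≤ p.2.1 ∧ 0 < p.2.2 ∧ p.2.2 < 1})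
    (𝓝 0)

/-- Polynomial tractability. -/
def PolynomiallyTractable (b : ℕ) (α β : ℝ) (γ₁ γ₂ : ℕ → ℝ) : Prop :=
  ∃ C τ₁ τ₂ : ℝ≥0, ∀ ε : ℝ, 0 < ε → ε < 1 → ∀ s t : ℕ, 1 ≤ s → 1 ≤ t →
    (infoComplexity b α β γ₁ γ₂ ε s t : ℝ≥0∞) ≤
      ENNReal.ofReal (C * ε ^ (-(τ₁ : ℝ)) * ((s : ℝ) + (t : ℝ)) ^ (τ₂ : ℝ))

/-- The bound `N(ε,s,t) ≤ C ε^(-τ)` for some `C ≥ 0` and all `ε ∈ (0,1)`, `s, t ≥ 1`. -/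
def StrongPolyBound (b : ℕ) (α β : ℝ) (γ₁ γ₂ : ℕ → ℝ) (τ : ℝ≥0) : Prop :=
  ∃ C : ℝ≥0, ∀ ε : ℝ, 0 < ε → ε < 1 → ∀ s t : ℕ, 1 ≤ s → 1 ≤ t →
    (infoComplexity b α β γ₁ γ₂ ε s t : ℝ≥0∞) ≤ ENNReal.ofReal (C * ε ^ (-(τ : ℝ)))

/-- Strong polynomial tractability. -/
def StronglyPolynomiallyTractable (b : ℕ) (α β : ℝ) (γ₁ γ₂ : ℕ → ℝ) : Prop :=
  ∃ τ : ℝ≥0, StrongPolyBound b α β γ₁ γ₂ τ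

/-- The `ε`-exponent of strong polynomial tractability (`∞` if there is no admissible `τ`). -/
noncomputable def epsExponent (b : ℕ) (α β : ℝ) (γ₁ γ₂ : ℕ → ℝ) : ℝ≥0∞ :=
  ⨅ (τ : ℝ≥0) (_ : StrongPolyBound b α β γ₁ γ₂ τ), (τ : ℝ≥0∞)

/-- The sum exponent `s_γ`, with the convention `inf ∅ = ∞`. -/
noncomputable def sumExponent (γ₁ γ₂ : ℕ → ℝ) : ℝ≥0∞ :=
  ⨅ (κ : ℝ≥0) (_ : 0 < κ ∧ Summable (fun j => γ₁ j ^ (κ : ℝ)) ∧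
    Summable (fun j => γ₂ j ^ (κ : ℝ))), (κ : ℝ≥0∞)

end HybridApprox

/-! The functions `basisFun` are unimodular and orthonormal, so everything reduces to an abstract
system `e h` with weights `d h` of finite trace `T = ∑' h, d h`. Keep the frequencies with `d h > ε²
/ 2`; there are at most `2 T / ε²` of them. Dropping the others costs at most `ε² / 2` in the
squared error. Each kept coefficient is estimated by the equal-weight rule `n⁻¹ ∑ f (x i) * conj (e
h (x i))`. For independent random points the squared worst-case errors of these rules have total
mean at most `card S * T / n`, and `exists_points` finds points at least this good. This is at most
`ε² / 2` once `n ≥ 4 T² / ε⁴` (`exists_approximation`).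

The trace is bounded by a product of one-dimensional sums `1 + γ_j c`, hence by the exponential of a
constant times the sum of the weights (`exists_tsum_decay_le`). The information complexity is thus
at most `5 exp (c (∑ γ₁ + ∑ γ₂)) ε⁻⁴`, with `c` independent of `s`, `t` and `ε`. All three claims
follow: bounded weight sums give the exponent `4`, logarithmic sums give a power of `s + t`, and
sublinear sums give weak tractability. -/

namespace HybridApprox

/-! ### Greedy choice of sample points and Parseval's identity. -/

section Abstract

/-- Multiplying the absolutely convergent series by its conjugate gives a double series, which
Parseval's identity integrates term by term. -/
lemma hasSum_mul_conj {ι X : Type*} {e : ι → X → ℂ} {c : ι → ℂ} {x : X} {v : ℂ}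
    (hv : HasSum (fun h => c h * e h x) v) :
    HasSum (fun p : ι × ι => (c p.1 * (starRingEnd ℂ) (c p.2)) *
      (e p.1 x * (starRingEnd ℂ) (e p.2 x))) ((‖v‖ ^ 2 : ℝ) : ℂ) := by
  have h2 : HasSum (fun h => (starRingEnd ℂ) (c h * e h x)) ((starRingEnd ℂ) v) :=
    Complex.hasSum_conj'.2 hv
  have h3 := hv.mul h2 (summable_mul_of_summable_norm (f := fun h => c h * e h x)
    (g := fun h => (starRingEnd ℂ) (c h * e h x)) hv.summable.norm h2.summable.norm)
  rw [Complex.mul_conj, Complex.normSq_eq_norm_sq] at h3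
  have h4 : ∀ p : ι × ι, c p.1 * e p.1 x * (starRingEnd ℂ) (c p.2 * e p.2 x) =
      (c p.1 * (starRingEnd ℂ) (c p.2)) * (e p.1 x * (starRingEnd ℂ) (e p.2 x)) := fun p => by
    rw [map_mul]; ring
  simpa only [h4] using h3

variable {X : Type*} [MeasurableSpace X] {μ : Measure X} [IsProbabilityMeasure μ]

/-- The cross term integrates to zero because `g` is centred. This is the cost of adding one random
point to points already fixed. -/
lemma lintegral_enorm_const_add_sq_le {g : X → ℂ} (hg : Measurable g)
    (hbdd : ∀ x, ‖g x‖ ≤ 1) (hmean : ∫ x, g x ∂μ = 0) (c : ℂ) :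
    ∫⁻ x, ‖c + g x‖ₑ ^ 2 ∂μ ≤ ‖c‖ₑ ^ 2 + 1 := by
  have hgi : Integrable g μ :=
    Integrable.of_bound hg.aestronglyMeasurable 1 (Eventually.of_forall hbdd)
  have hg2 : Integrable (fun x => ‖g x‖ ^ 2) μ := by
    refine Integrable.of_bound (by fun_prop) 1 (Eventually.of_forall fun x => ?_)
    rw [Real.norm_of_nonneg (by positivity)]
    nlinarith [hbdd x, norm_nonneg (g x)]
  have hin : Integrable (fun x => inner ℝ c (g x)) μ := hgi.const_inner c
  have hvar : ∫ x, ‖g x‖ ^ 2 ∂μ ≤ 1 := by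
    calc ∫ x, ‖g x‖ ^ 2 ∂μ ≤ ∫ _, (1 : ℝ) ∂μ :=
          integral_mono hg2 (integrable_const _) fun x => pow_le_one₀ (norm_nonneg _) (hbdd x)
      _ = 1 := by simp
  have key : ∫ x, ‖c + g x‖ ^ 2 ∂μ ≤ ‖c‖ ^ 2 + 1 := by
    have h0 : ∫ x, inner ℝ c (g x) ∂μ = 0 := by
      rw [integral_inner hgi, hmean, inner_zero_right]
    have h1 : ∀ x, ‖c + g x‖ ^ 2 = ‖c‖ ^ 2 + 2 * inner ℝ c (g x) + ‖g x‖ ^ 2 :=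
      fun x => norm_add_sq_real c (g x)
    simp_rw [h1]
    have hi : Integrable (fun x => 2 * inner ℝ c (g x)) μ := hin.const_mul 2
    have hi' : Integrable (fun x => ‖c‖ ^ 2 + 2 * inner ℝ c (g x)) μ := (integrable_const _).add hi
    rw [integral_add hi' hg2, integral_add (integrable_const _) hi, integral_const_mul, h0]
    simpa using hvar
  have hint : Integrable (fun x => ‖c + g x‖ ^ 2) μ := by
    refine Integrable.of_bound (by fun_prop) ((‖c‖ + 1) ^ 2) (Eventually.of_forall fun x => ?_)
    rw [Real.norm_of_nonneg (by positivity)]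
    gcongr
    exact (norm_add_le _ _).trans (by gcongr; exact hbdd x)
  have hconv : ∀ z : ℂ, ‖z‖ₑ ^ 2 = ENNReal.ofReal (‖z‖ ^ 2) := fun z => by
    rw [ENNReal.ofReal_pow (norm_nonneg _), ofReal_norm]
  simp_rw [hconv]
  rw [← ofReal_integral_eq_lintegral_ofReal hint (Eventually.of_forall fun x => by positivity),
    ← ENNReal.ofReal_one, ← ENNReal.ofReal_add (by positivity) zero_le_one]
  exact ENNReal.ofReal_le_ofReal key

/-- Sample points, chosen one after the other, at which the weighted sum of squares of the sums of
centred functions does not exceed its mean for independent points. -/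
lemma exists_points {κ : Type*} [Countable κ] {g : κ → X → ℂ} (hg : ∀ p, Measurable (g p))
    (hbdd : ∀ p x, ‖g p x‖ ≤ 1) (hmean : ∀ p, ∫ x, g p x ∂μ = 0) (w : κ → ℝ≥0∞) (n : ℕ) :
    ∃ x : Fin n → X, ∑' p, w p * ‖∑ i, g p (x i)‖ₑ ^ 2 ≤ n * ∑' p, w p := by
  induction n with
  | zero => exact ⟨Fin.elim0, by simp⟩
  | succ n ih =>
    obtain ⟨x, hx⟩ := ih
    have hm : ∀ p, Measurable fun y => w p * ‖(∑ i, g p (x i)) + g p y‖ₑ ^ 2 := fun p => by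
      have := hg p
      fun_prop
    -- Some point does not exceed the mean over the new point, with the earlier points fixed; one
    -- `y` serves all `p` because the weighted sum is averaged as a whole.
    obtain ⟨y, hy⟩ := exists_le_lintegral (μ := μ)
      (f := fun y => ∑' p, w p * ‖(∑ i, g p (x i)) + g p y‖ₑ ^ 2)
      (Measurable.tsum hm).aemeasurable
    refine ⟨Fin.snoc x y, ?_⟩
    simp only [Fin.sum_univ_castSucc, Fin.snoc_castSucc, Fin.snoc_last]
    refine hy.trans ?_
    rw [lintegral_tsum fun p => (hm p).aemeasurable]
    calc ∑' p, ∫⁻ y, w p * ‖(∑ i, g p (x i)) + g p y‖ₑ ^ 2 ∂μ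
        ≤ ∑' p, (w p * ‖∑ i, g p (x i)‖ₑ ^ 2 + w p) := by
          refine ENNReal.tsum_le_tsum fun p => ?_
          have := hg p
          rw [lintegral_const_mul _ (by fun_prop)]
          calc w p * ∫⁻ y, ‖(∑ i, g p (x i)) + g p y‖ₑ ^ 2 ∂μ
              ≤ w p * (‖∑ i, g p (x i)‖ₑ ^ 2 + 1) := by
                gcongr
                exact lintegral_enorm_const_add_sq_le (hg p) (hbdd p) (hmean p) _
            _ = _ := by rw [mul_add, mul_one]
      _ = ∑' p, w p * ‖∑ i, g p (x i)‖ₑ ^ 2 + ∑' p, w p := ENNReal.tsum_add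
      _ ≤ n * ∑' p, w p + ∑' p, w p := by gcongr
      _ = _ := by push_cast; ring

/-- The weighted Cauchy-Schwarz inequality for series. -/
lemma norm_sq_le_of_hasSum_mul {ι : Type*} {d : ι → ℝ} (hd : ∀ h, 0 < d h) {c G : ι → ℂ} {v : ℂ}
    (hv : HasSum (fun h => c h * G h) v) {A B : ℝ}
    (hA : ∀ F : Finset ι, ∑ h ∈ F, (d h)⁻¹ * ‖c h‖ ^ 2 ≤ A)
    (hB : ∀ F : Finset ι, ∑ h ∈ F, d h * ‖G h‖ ^ 2 ≤ B) : ‖v‖ ^ 2 ≤ A * B := by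
  refine le_of_tendsto ((Filter.Tendsto.norm hv).pow 2) (Eventually.of_forall fun F => ?_)
  calc ‖∑ h ∈ F, c h * G h‖ ^ 2 ≤ (∑ h ∈ F, ‖c h‖ * ‖G h‖) ^ 2 := by
        gcongr
        exact (norm_sum_le _ _).trans_eq (by simp)
    _ ≤ (∑ h ∈ F, (d h)⁻¹ * ‖c h‖ ^ 2) * ∑ h ∈ F, d h * ‖G h‖ ^ 2 := by
        refine Finset.sum_sq_le_sum_mul_sum_of_sq_le_mul F ?_ ?_ ?_
        · intro h _; have := hd h; positivity
        · intro h _; have := hd h; positivity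
        · intro h _; have := (hd h).ne'; exact le_of_eq (by field_simp)
    _ ≤ A * B := by
        have hA0 : (0 : ℝ) ≤ A := by simpa using hA ∅
        refine mul_le_mul (hA F) (hB F) (Finset.sum_nonneg fun h _ => ?_) hA0
        have := hd h; positivity

/-- A system of measurable unimodular functions that is orthonormal in `L₂(μ)`. -/
structure UnimodularSystem {ι : Type*} (μ : Measure X) (e : ι → X → ℂ) : Prop where
  measurable : ∀ h, Measurable (e h)
  norm_eq_one : ∀ h x, ‖e h x‖ = 1
  integral_mul_conj : ∀ h, ∫ x, e h x * (starRingEnd ℂ) (e h x) ∂μ = 1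
  integral_mul_conj_of_ne : ∀ h h', h ≠ h' → ∫ x, e h x * (starRingEnd ℂ) (e h' x) ∂μ = 0

namespace UnimodularSystem

variable {ι : Type*} {e : ι → X → ℂ}

/-- Parseval's identity for absolutely convergent series. -/
lemma hasSum_integral_norm_sq [Countable ι] (he : UnimodularSystem μ e) {c : ι → ℂ}
    (hc : Summable fun h => ‖c h‖) {g : X → ℂ} (hg : ∀ x, HasSum (fun h => c h * e h x) (g x)) :
    HasSum (fun h => ‖c h‖ ^ 2) (∫ x, ‖g x‖ ^ 2 ∂μ) := by
  have hFn : ∀ (p : ι × ι) x, ‖(c p.1 * (starRingEnd ℂ) (c p.2)) *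
      (e p.1 x * (starRingEnd ℂ) (e p.2 x))‖ = ‖c p.1‖ * ‖c p.2‖ := fun p x => by
    simp [he.norm_eq_one]
  have hcc : Summable fun p : ι × ι => ‖c p.1‖ * ‖c p.2‖ :=
    hc.mul_of_nonneg hc (fun _ => norm_nonneg _) (fun _ => norm_nonneg _)
  have hFm : ∀ p : ι × ι, Measurable fun x => (c p.1 * (starRingEnd ℂ) (c p.2)) *
      (e p.1 x * (starRingEnd ℂ) (e p.2 x)) := fun p =>
    ((he.measurable p.1).mul
      (Complex.continuous_conj.measurable.comp (he.measurable p.2))).const_mul _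
  have hFi : ∀ p : ι × ι, Integrable (fun x => (c p.1 * (starRingEnd ℂ) (c p.2)) *
      (e p.1 x * (starRingEnd ℂ) (e p.2 x))) μ := fun p =>
    Integrable.of_bound (hFm p).aestronglyMeasurable _ (Eventually.of_forall fun x => (hFn p x).le)
  have hI := hasSum_integral_of_summable_integral_norm hFi (by simpa only [hFn, integral_const, probReal_univ, one_smul] using hcc)
  simp only [fun x => (hasSum_mul_conj (hg x)).tsum_eq, integral_const_mul] at hI
  rw [integral_complex_ofReal] at hI
  -- By orthogonality only the diagonal of the double series contributes.
  have hinj : Function.Injective fun h : ι => (h, h) := fun h h' hh => congrArg Prod.fst hh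
  rw [← hinj.hasSum_iff] at hI
  · rw [← Complex.hasSum_ofReal]
    have h1 : ∀ h, ((‖c h‖ ^ 2 : ℝ) : ℂ) = c h * (starRingEnd ℂ) (c h) *
        ∫ x, e h x * (starRingEnd ℂ) (e h x) ∂μ := fun h => by
      rw [he.integral_mul_conj, mul_one, Complex.mul_conj, Complex.normSq_eq_norm_sq]
    simp only [h1]
    exact hI
  · rintro ⟨h, h'⟩ hh
    rw [he.integral_mul_conj_of_ne _ _ fun h0 => hh ⟨h, by simpa using h0⟩, mul_zero]

end UnimodularSystem
end Abstract
-- Approximation from function values for a unimodular orthonormal system.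
namespace UnimodularSystem

variable {X : Type*} [MeasurableSpace X] {μ : Measure X} [IsProbabilityMeasure μ]
  {ι : Type*} [Countable ι] {e : ι → X → ℂ}

-- `B h` bounds the squared norm of the error functional, before division by `n`, of the rule that
-- estimates the coefficient at `h`. The functions `e h' * conj (e h)`, less the Kronecker delta,
-- are centred and bounded by `1`, so `exists_points` over all pairs in `S × ι` provides common
-- points for all `h ∈ S`.
open Classical in
lemma exists_quadrature (he : UnimodularSystem μ e) {d : ι → ℝ} (hd : ∀ h, 0 < d h)
    (hT : Summable d) (S : Finset ι) (n : ℕ) :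
    ∃ (x : Fin n → X) (B : ι → ℝ),
      (∀ h ∈ S, ∀ F : Finset ι, ∑ h' ∈ F, d h' *
        ‖∑ i, (e h' (x i) * (starRingEnd ℂ) (e h (x i)) - if h' = h then 1 else 0)‖ ^ 2 ≤ B h) ∧
      ∑ h ∈ S, B h ≤ n * (S.card * ∑' h, d h) := by
  have hpt : ∀ h h' x, ‖e h' x * (starRingEnd ℂ) (e h x) - if h' = h then 1 else 0‖ ≤ 1 := by
    intro h h' x
    split_ifs with hh
    · subst hh
      rw [Complex.mul_conj, Complex.normSq_eq_norm_sq, he.norm_eq_one]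
      simp
    · simp [he.norm_eq_one]
  have hmeas : ∀ h h', Measurable fun x => e h' x * (starRingEnd ℂ) (e h x) := fun h h' =>
    (he.measurable h').mul (Complex.continuous_conj.measurable.comp (he.measurable h))
  have hint : ∀ h h', Integrable (fun x => e h' x * (starRingEnd ℂ) (e h x)) μ := fun h h' =>
    Integrable.of_bound (hmeas h h').aestronglyMeasurable 1
      (Eventually.of_forall fun x => by simp [he.norm_eq_one])
  obtain ⟨x, hx⟩ := exists_points (μ := μ) (κ := S × ι)
    (g := fun p x => e p.2 x * (starRingEnd ℂ) (e p.1 x) - if p.2 = p.1 then 1 else 0)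
    (fun p => (hmeas _ _).sub_const _) (fun p x => hpt _ _ _)
    (fun p => by
      rw [integral_sub (hint _ _) (integrable_const _)]
      split_ifs with hh
      · rw [hh, he.integral_mul_conj]; simp
      · rw [he.integral_mul_conj_of_ne _ _ hh]; simp)
    (fun p => ENNReal.ofReal (d p.2)) n
  have hd0 : 0 ≤ ∑' h, d h := tsum_nonneg fun h => (hd h).le
  rw [ENNReal.tsum_prod (f := fun (_ : S) h => ENNReal.ofReal (d h)),
    ENNReal.tsum_prod (f := fun (h : S) h' => ENNReal.ofReal (d h') *
      ‖∑ i, (e h' (x i) * (starRingEnd ℂ) (e h (x i)) - if h' = h then 1 else 0)‖ₑ ^ 2),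
    tsum_fintype, tsum_fintype, Finset.sum_const, Finset.card_univ, Fintype.card_coe,
    ← ENNReal.ofReal_tsum_of_nonneg (fun h => (hd h).le) hT,
    Finset.sum_coe_sort S (fun h => ∑' h', ENNReal.ofReal (d h') *
      ‖∑ i, (e h' (x i) * (starRingEnd ℂ) (e h (x i)) - if h' = h then 1 else 0)‖ₑ ^ 2)] at hx
  set b : ι → ℝ≥0∞ := fun h => ∑' h', ENNReal.ofReal (d h') *
      ‖∑ i, (e h' (x i) * (starRingEnd ℂ) (e h (x i)) - if h' = h then 1 else 0)‖ₑ ^ 2 with hb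
  have hx' : ∑ h ∈ S, b h ≤ ENNReal.ofReal (n * (S.card * ∑' h, d h)) := by
    refine hx.trans_eq ?_
    rw [ENNReal.ofReal_mul (by positivity), ENNReal.ofReal_mul (by positivity),
      ENNReal.ofReal_natCast, ENNReal.ofReal_natCast, nsmul_eq_mul]
  have hfin : ∀ h ∈ S, b h ≠ ⊤ := fun h hh =>
    ne_top_of_le_ne_top ENNReal.ofReal_ne_top
      ((Finset.single_le_sum (fun _ _ => zero_le) hh).trans hx')
  refine ⟨x, fun h => (b h).toReal, fun h hh F => ?_, ?_⟩
  · rw [← ENNReal.ofReal_le_iff_le_toReal (hfin h hh),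
      ENNReal.ofReal_sum_of_nonneg fun h' _ => mul_nonneg (hd h').le (by positivity)]
    refine le_trans (le_of_eq (Finset.sum_congr rfl fun h' _ => ?_)) (ENNReal.sum_le_tsum F)
    rw [ENNReal.ofReal_mul (hd h').le, ENNReal.ofReal_pow (norm_nonneg _), ofReal_norm]
  · rw [← ENNReal.toReal_sum hfin]
    exact ENNReal.toReal_le_of_le_ofReal (by positivity) hx'

lemma memLp_of_hasSum (he : UnimodularSystem μ e) {c : ι → ℂ}
    (hc : Summable fun h => ‖c h‖) {g : X → ℂ} (hg : ∀ x, HasSum (fun h => c h * e h x) (g x)) :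
    MemLp g 2 μ := by
  have hm : Measurable g := by
    refine measurable_of_tendsto_metrizable' (f := fun (F : Finset ι) x => ∑ h ∈ F, c h * e h x)
      atTop (fun F => Finset.measurable_sum F fun h _ => (he.measurable h).const_mul _) ?_
    exact tendsto_pi_nhds.2 hg
  refine MemLp.of_bound hm.aestronglyMeasurable (∑' h, ‖c h‖) (Eventually.of_forall fun x => ?_)
  rw [← (hg x).tsum_eq]
  refine tsum_of_norm_bounded hc.hasSum fun h => ?_
  simp [he.norm_eq_one]

lemma eLpNorm_le_of_hasSum (he : UnimodularSystem μ e) {c : ι → ℂ}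
    (hc : Summable fun h => ‖c h‖) {g : X → ℂ} (hg : ∀ x, HasSum (fun h => c h * e h x) (g x))
    {ε : ℝ} (hε : 0 ≤ ε) (hle : ∀ F : Finset ι, ∑ h ∈ F, ‖c h‖ ^ 2 ≤ ε ^ 2) :
    eLpNorm g 2 μ ≤ ENNReal.ofReal ε := by
  have h1 := hasSum_le_of_sum_le (he.hasSum_integral_norm_sq hc hg) hle
  rw [(he.memLp_of_hasSum hc hg).eLpNorm_eq_integral_rpow_norm two_ne_zero ENNReal.ofNat_ne_top]
  refine ENNReal.ofReal_le_ofReal ?_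
  simp only [ENNReal.toReal_ofNat, Real.rpow_two]
  rw [show (2 : ℝ)⁻¹ = 1 / 2 by norm_num, ← Real.sqrt_eq_rpow]
  exact Real.sqrt_le_iff.2 ⟨hε, h1⟩

open Classical in
/-- Approximation from `n` function values, with a number of values that is bounded in terms of
the trace `∑' h, d h`. -/
theorem exists_approximation [Nonempty ι] (he : UnimodularSystem μ e) {d : ι → ℝ}
    (hd : ∀ h, 0 < d h) (hT : Summable d) {ε : ℝ} (hε : 0 < ε) {n : ℕ}
    (hn : 4 * (∑' h, d h) ^ 2 * (ε ^ 4)⁻¹ ≤ n) :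
    ∃ (x : Fin n → X) (a : Fin n → X → ℂ), (∀ k, MemLp (a k) 2 μ) ∧
      ∀ (f : X → ℂ) (c : ι → ℂ), (∀ z, HasSum (fun h => c h * e h z) (f z)) →
        (∀ F : Finset ι, ∑ h ∈ F, (d h)⁻¹ * ‖c h‖ ^ 2 ≤ 1) →
        eLpNorm (fun z => f z - ∑ k, a k z * f (x k)) 2 μ ≤ ENNReal.ofReal ε := by
  set T := ∑' h, d h with hTdef
  have hTpos : 0 < T := hT.tsum_pos (fun h => (hd h).le) (Classical.arbitrary ι) (hd _)
  have hn0 : (0 : ℝ) < n := lt_of_lt_of_le (by positivity) hn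
  have hfin : {h | ε ^ 2 / 2 < d h}.Finite := by
    have := hT.tendsto_cofinite_zero.eventually_le_const (show (0 : ℝ) < ε ^ 2 / 2 by positivity)
    simpa only [Filter.Eventually, mem_cofinite, Set.compl_ofPred, not_le] using this
  set S := hfin.toFinset with hS
  -- Each kept frequency contributes more than `ε² / 2` to the trace.
  have hcard : S.card * (ε ^ 2 / 2) ≤ T := by
    calc (S.card : ℝ) * (ε ^ 2 / 2) = ∑ h ∈ S, ε ^ 2 / 2 := by simp
      _ ≤ ∑ h ∈ S, d h := Finset.sum_le_sum fun h hh => le_of_lt (by simpa [hS] using hh)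
      _ ≤ T := hT.sum_le_tsum S fun h _ => (hd h).le
  -- The lower bound on `n` enters here: `card S * T ≤ 2 T² / ε²`, and `n ≥ 4 T² / ε⁴` brings the
  -- quotient down to `ε² / 2`.
  have hquot : (n : ℝ)⁻¹ * (S.card * T) ≤ ε ^ 2 / 2 := by
    rw [inv_mul_le_iff₀ hn0]
    have h1 : 4 * T ^ 2 ≤ n * ε ^ 4 := by
      rwa [← div_eq_mul_inv, div_le_iff₀ (by positivity)] at hn
    have h2 : S.card * ε ^ 2 ≤ 2 * T := by linarith
    have h3 : (S.card * T) * ε ^ 2 ≤ 2 * T ^ 2 := by nlinarith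
    have h4 : (S.card * T) * ε ^ 2 ≤ (n * (ε ^ 2 / 2)) * ε ^ 2 := by nlinarith
    exact le_of_mul_le_mul_right h4 (by positivity)
  obtain ⟨x, B, hB, hBsum⟩ := he.exists_quadrature hd hT S n
  refine ⟨x, fun i z => ∑ h ∈ S, ((n : ℂ)⁻¹ * (starRingEnd ℂ) (e h (x i))) * e h z, fun i => ?_,
    fun f c hf hc => ?_⟩
  · refine memLp_finsetSum _ fun h _ => MemLp.const_mul ?_ _
    exact MemLp.of_bound (he.measurable h).aestronglyMeasurable 1
      (Eventually.of_forall fun z => (he.norm_eq_one h z).le)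
  set q : ι → ℂ := fun h => (n : ℂ)⁻¹ * ∑ i, f (x i) * (starRingEnd ℂ) (e h (x i)) with hq
  -- These are the coefficients of `f - A(f)`: quadrature errors on `S`, the original coefficients
  -- elsewhere.
  set c' : ι → ℂ := fun h => c h - if h ∈ S then q h else 0 with hc'
  -- Since `‖e h z‖ = 1`, absolute convergence at a single point already gives summable
  -- coefficients.
  have hcs : Summable fun h => ‖c h‖ := by
    obtain ⟨z⟩ : Nonempty X := Measure.nonempty_of_neZero μ
    simpa [he.norm_eq_one] using (hf z).summable.norm
  have hcs' : Summable fun h => ‖c' h‖ := by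
    refine (hcs.of_norm.sub (summable_of_hasFiniteSupport ?_)).norm
    exact S.finite_toSet.subset fun h hh => by
      by_contra h0
      exact hh (if_neg h0)
  have hg : ∀ z, HasSum (fun h => c' h * e h z)
      (f z - ∑ k, (∑ h ∈ S, ((n : ℂ)⁻¹ * (starRingEnd ℂ) (e h (x k))) * e h z) * f (x k)) := by
    intro z
    have h1 : HasSum (fun h => (if h ∈ S then q h else 0) * e h z)
        (∑ h ∈ S, (if h ∈ S then q h else 0) * e h z) :=
      hasSum_sum_of_ne_finset_zero fun h hh => by simp [hh]
    have h2 : ∑ k, (∑ h ∈ S, ((n : ℂ)⁻¹ * (starRingEnd ℂ) (e h (x k))) * e h z) * f (x k) =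
        ∑ h ∈ S, (if h ∈ S then q h else 0) * e h z := by
      simp_rw [Finset.sum_mul]
      rw [Finset.sum_comm]
      refine Finset.sum_congr rfl fun h hh => ?_
      rw [if_pos hh, hq]
      simp only [Finset.mul_sum, Finset.sum_mul]
      exact Finset.sum_congr rfl fun i _ => by ring
    rw [h2]
    refine ((hf z).sub h1).congr_fun fun h => ?_
    rw [hc', sub_mul]
  -- The quadrature error is linear in the coefficients `c`, so weighted Cauchy-Schwarz bounds it
  -- uniformly over the unit ball by `B h`.
  have hin : ∀ h ∈ S, ‖c' h‖ ^ 2 ≤ ((n : ℝ)⁻¹) ^ 2 * B h := by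
    intro h hh
    have h1 : HasSum (fun h' => c h' * ∑ i, (e h' (x i) * (starRingEnd ℂ) (e h (x i)) -
        if h' = h then 1 else 0)) (∑ i, (f (x i) * (starRingEnd ℂ) (e h (x i)) - c h)) := by
      simp_rw [Finset.mul_sum]
      refine hasSum_sum fun i _ => ?_
      have h2 : HasSum (fun h' => c h' * if h' = h then (1 : ℂ) else 0) (c h) := by
        simpa using hasSum_single (f := fun h' => c h' * if h' = h then (1 : ℂ) else 0) h
          (fun h' hne => by simp [hne])
      refine (((hf (x i)).mul_right ((starRingEnd ℂ) (e h (x i)))).sub h2).congr_fun fun h' => ?_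
      ring
    have h3 := norm_sq_le_of_hasSum_mul hd h1 hc (hB h hh)
    have h4 : c' h = -((n : ℂ)⁻¹ * ∑ i, (f (x i) * (starRingEnd ℂ) (e h (x i)) - c h)) := by
      have hnc : (n : ℂ) ≠ 0 := by exact_mod_cast hn0.ne'
      simp only [hc', hq, if_pos hh, Finset.sum_sub_distrib, Finset.sum_const, Finset.card_univ,
        Fintype.card_fin, nsmul_eq_mul]
      field_simp
      ring
    rw [h4, norm_neg, norm_mul, mul_pow, norm_inv, Complex.norm_natCast]
    gcongr
    linarith
  refine he.eLpNorm_le_of_hasSum hcs' hg hε.le fun F => ?_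
  rw [← Finset.sum_filter_add_sum_filter_not F (· ∈ S)]
  have hleft : ∑ h ∈ F with h ∈ S, ‖c' h‖ ^ 2 ≤ ε ^ 2 / 2 := by
    calc ∑ h ∈ F with h ∈ S, ‖c' h‖ ^ 2 ≤ ∑ h ∈ S, ‖c' h‖ ^ 2 :=
          Finset.sum_le_sum_of_subset_of_nonneg (fun h hh => (Finset.mem_filter.1 hh).2)
            fun _ _ _ => by positivity
      _ ≤ ∑ h ∈ S, ((n : ℝ)⁻¹) ^ 2 * B h := Finset.sum_le_sum hin
      _ = ((n : ℝ)⁻¹) ^ 2 * ∑ h ∈ S, B h := by rw [Finset.mul_sum]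
      _ ≤ ((n : ℝ)⁻¹) ^ 2 * (n * (S.card * T)) := by gcongr
      _ = (n : ℝ)⁻¹ * (S.card * T) := by field_simp
      _ ≤ _ := hquot
  have hright : ∑ h ∈ F with h ∉ S, ‖c' h‖ ^ 2 ≤ ε ^ 2 / 2 := by
    calc ∑ h ∈ F with h ∉ S, ‖c' h‖ ^ 2
        ≤ ∑ h ∈ F with h ∉ S, ε ^ 2 / 2 * ((d h)⁻¹ * ‖c h‖ ^ 2) := by
          refine Finset.sum_le_sum fun h hh => ?_
          have hhS := (Finset.mem_filter.1 hh).2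
          have hdh : d h ≤ ε ^ 2 / 2 := by simpa [hS] using hhS
          have h1 : 1 ≤ ε ^ 2 / 2 * (d h)⁻¹ := by
            rw [← div_eq_mul_inv, le_div_iff₀ (hd h), one_mul]
            exact hdh
          simp only [hc', if_neg hhS, sub_zero]
          rw [← mul_assoc]
          exact le_mul_of_one_le_left (by positivity) h1
      _ = ε ^ 2 / 2 * ∑ h ∈ F with h ∉ S, (d h)⁻¹ * ‖c h‖ ^ 2 := by rw [Finset.mul_sum]
      _ ≤ ε ^ 2 / 2 * 1 := by gcongr; exact hc _
      _ = _ := mul_one _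
  linarith

end UnimodularSystem

/-! ### Orthonormality of the Walsh functions -/

/-- Digits of `k` beyond its length vanish, so the digit sum may be padded to any length `n`. This
lets `k` and `k / b` be compared. -/
lemma wal_eq_pow {b k n : ℕ} (hb : 1 < b) (hn : Nat.log b k < n) (x : ℝ) :
    wal b k x = Complex.exp (2 * Real.pi * Complex.I / b) ^
      (∑ j ∈ Finset.range n, (⌊(b : ℝ) ^ (j + 1) * x⌋₊ % b) * (k / b ^ j % b)) := by
  have h1 : ∑ j ∈ Finset.range (Nat.log b k + 1), (⌊(b : ℝ) ^ (j + 1) * x⌋₊ % b) * (k / b ^ j % b)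
      = ∑ j ∈ Finset.range n, (⌊(b : ℝ) ^ (j + 1) * x⌋₊ % b) * (k / b ^ j % b) := by
    refine Finset.sum_subset (Finset.range_mono hn) fun j _ hj => ?_
    have hj' : Nat.log b k + 1 ≤ j := by simpa using hj
    have : k < b ^ j := (Nat.lt_pow_succ_log_self hb k).trans_le (Nat.pow_le_pow_right hb.le hj')
    rw [Nat.div_eq_of_lt this]
    simp
  rw [wal, h1, ← Complex.exp_nat_mul]
  congr 1
  ring

lemma norm_wal (b k : ℕ) (x : ℝ) : ‖wal b k x‖ = 1 := by
  rw [wal, Complex.norm_exp]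
  simp [Complex.div_re, Complex.mul_re, Complex.mul_im, Complex.normSq]

lemma measurable_wal (b k : ℕ) : Measurable (wal b k) := by
  have h1 : Measurable fun x : ℝ => ∑ j ∈ Finset.range (Nat.log b k + 1),
      (⌊(b : ℝ) ^ (j + 1) * x⌋₊ % b) * (k / b ^ j % b) := by
    refine Finset.measurable_sum _ fun j _ => ?_
    have h2 : Measurable fun x : ℝ => ⌊(b : ℝ) ^ (j + 1) * x⌋₊ :=
      Nat.measurable_floor.comp (measurable_const_mul _)
    exact (measurable_from_nat (f := fun m => m % b * (k / b ^ j % b))).comp h2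
  exact (measurable_from_nat (f := fun m : ℕ =>
    Complex.exp (2 * Real.pi * Complex.I * ((m : ℂ) / (b : ℂ))))).comp h1

/-- The first digit of `(d + y) / b` is `d` and the remaining ones are those of `y`. Splitting off
the lowest digit of `k` therefore factors the Walsh function. -/
lemma wal_add_div {b : ℕ} (hb : 1 < b) (k : ℕ) {d : ℕ} (hd : d < b) {y : ℝ}
    (hy : y ∈ Set.Ico (0 : ℝ) 1) :
    wal b k (d / b + y / b) =
      Complex.exp (2 * Real.pi * Complex.I / b) ^ (d * (k % b)) * wal b (k / b) y := by
  have hb0 : (b : ℝ) ≠ 0 := by positivity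
  have hlog : Nat.log b (k / b) < Nat.log b k + 1 :=
    Nat.lt_succ_of_le (Nat.log_mono_right (Nat.div_le_self _ _))
  rw [wal_eq_pow hb (show Nat.log b k < Nat.log b k + 1 + 1 by omega), wal_eq_pow hb hlog,
    ← pow_add, Finset.sum_range_succ', add_comm]
  have h0 : ⌊(b : ℝ) ^ (0 + 1) * (d / b + y / b)⌋₊ = d := by
    have : (b : ℝ) ^ (0 + 1) * (d / b + y / b) = y + d := by field_simp; ring
    rw [this, Nat.floor_add_natCast hy.1, Nat.floor_eq_zero.2 hy.2, zero_add]
  rw [h0, Nat.mod_eq_of_lt hd, pow_zero, Nat.div_one]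
  congr 2
  refine Finset.sum_congr rfl fun j _ => ?_
  have hj : (b : ℝ) ^ (j + 1 + 1) * (d / b + y / b) =
      (b : ℝ) ^ (j + 1) * y + ((b * (b ^ j * d) : ℕ) : ℝ) := by
    push_cast; field_simp; ring
  rw [hj, Nat.floor_add_natCast (mul_nonneg (by positivity) hy.1), Nat.add_mul_mod_self_left,
    pow_succ' b j, Nat.div_div_eq_div_mul]

/-- A geometric sum over the `b`-th roots of unity; `κ, κ' < b` ensures that different exponents
give different powers of the primitive root. -/
lemma sum_exp_digit {b : ℕ} (hb : 1 < b) {κ κ' : ℕ} (h : κ < b) (h' : κ' < b) :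
    ∑ d ∈ Finset.range b, Complex.exp (2 * Real.pi * Complex.I / b) ^ (d * κ) *
      (starRingEnd ℂ) (Complex.exp (2 * Real.pi * Complex.I / b) ^ (d * κ')) =
      if κ = κ' then (b : ℂ) else 0 := by
  set ζ := Complex.exp (2 * Real.pi * Complex.I / b) with hζ
  have hprim : IsPrimitiveRoot ζ b := Complex.isPrimitiveRoot_exp b (by omega)
  have hconj : (starRingEnd ℂ) ζ = ζ⁻¹ :=
    (Complex.inv_eq_conj (hprim.norm'_eq_one (by omega))).symm
  have hζ0 : ζ ≠ 0 := Complex.exp_ne_zero _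
  have hterm : ∀ d, ζ ^ (d * κ) * (starRingEnd ℂ) (ζ ^ (d * κ')) = (ζ ^ κ * (ζ ^ κ')⁻¹) ^ d := by
    intro d
    rw [map_pow, hconj, mul_pow, ← pow_mul, inv_pow, inv_pow, ← pow_mul, mul_comm d, mul_comm d]
  simp_rw [hterm]
  split_ifs with hκ
  · subst hκ
    rw [mul_inv_cancel₀ (pow_ne_zero _ hζ0)]
    simp
  · have hne : ζ ^ κ * (ζ ^ κ')⁻¹ - 1 ≠ 0 := by
      rw [sub_ne_zero]
      intro h1
      rw [mul_inv_eq_one₀ (pow_ne_zero _ hζ0)] at h1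
      exact hκ (hprim.pow_inj h h' h1)
    refine (mul_eq_zero.1 ?_).resolve_left hne
    rw [mul_geom_sum, mul_pow, inv_pow, ← pow_mul, ← pow_mul, mul_comm κ, mul_comm κ', pow_mul,
      pow_mul, hprim.pow_eq_one]
    simp

lemma intervalIntegrable_wal_mul_conj (b k k' : ℕ) (u v : ℝ) :
    IntervalIntegrable (fun x => wal b k x * (starRingEnd ℂ) (wal b k' x)) volume u v := by
  have hm : Measurable fun x => wal b k x * (starRingEnd ℂ) (wal b k' x) :=
    (measurable_wal b k).mul (Complex.continuous_conj.measurable.comp (measurable_wal b k'))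
  refine (intervalIntegrable_const (c := (1 : ℝ))).mono_fun hm.aestronglyMeasurable
    (Eventually.of_forall fun x => ?_)
  simp [norm_wal]

/-- Self-similarity: cut `[0,1)` into `b` equal pieces and rescale each to `[0,1)`. The first digits
contribute a character sum, the rest the same integral for `k / b` and `k' / b`. -/
lemma integral_wal_mul_conj_eq_mul {b : ℕ} (hb : 1 < b) (k k' : ℕ) :
    ∫ x in (0 : ℝ)..1, wal b k x * (starRingEnd ℂ) (wal b k' x) =
      (if k % b = k' % b then 1 else 0) *
        ∫ x in (0 : ℝ)..1, wal b (k / b) x * (starRingEnd ℂ) (wal b (k' / b) x) := by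
  have hb0 : (b : ℝ) ≠ 0 := by positivity
  have hbc : (b : ℂ) ≠ 0 := by exact_mod_cast hb0
  have hsplit := intervalIntegral.sum_integral_adjacent_intervals (n := b)
    (a := fun d : ℕ => (d : ℝ) / b)
    (fun d _ => intervalIntegrable_wal_mul_conj b k k' ((d : ℝ) / b) (((d + 1 : ℕ) : ℝ) / b))
  simp only [Nat.cast_zero, zero_div, div_self hb0] at hsplit
  rw [← hsplit]
  have hpiece : ∀ d ∈ Finset.range b,
      ∫ x in ((d : ℝ) / b)..(((d + 1 : ℕ) : ℝ) / b), wal b k x * (starRingEnd ℂ) (wal b k' x) =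
      (b : ℂ)⁻¹ * ((Complex.exp (2 * Real.pi * Complex.I / b) ^ (d * (k % b)) *
        (starRingEnd ℂ) (Complex.exp (2 * Real.pi * Complex.I / b) ^ (d * (k' % b)))) *
        ∫ x in (0 : ℝ)..1, wal b (k / b) x * (starRingEnd ℂ) (wal b (k' / b) x)) := by
    intro d hd
    have h1 := intervalIntegral.integral_comp_add_div (a := 0) (b := 1)
      (fun x => wal b k x * (starRingEnd ℂ) (wal b k' x)) hb0 ((d : ℝ) / b)
    rw [zero_div, add_zero, show (d : ℝ) / b + 1 / b = ((d + 1 : ℕ) : ℝ) / b by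
      push_cast; ring] at h1
    have h2 : ∫ x in (0 : ℝ)..1,
        wal b k (d / b + x / b) * (starRingEnd ℂ) (wal b k' (d / b + x / b)) =
        ∫ x in (0 : ℝ)..1, (Complex.exp (2 * Real.pi * Complex.I / b) ^ (d * (k % b)) *
        (starRingEnd ℂ) (Complex.exp (2 * Real.pi * Complex.I / b) ^ (d * (k' % b)))) *
        (wal b (k / b) x * (starRingEnd ℂ) (wal b (k' / b) x)) := by
      -- Agreement on the open interval suffices, which avoids the endpoint `1`, where the
      -- factorisation is not available.
      refine intervalIntegral.integral_congr_uIoo fun x hx => ?_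
      rw [Set.uIoo_of_le zero_le_one] at hx
      have hx' : x ∈ Set.Ico (0 : ℝ) 1 := ⟨hx.1.le, hx.2⟩
      have hd' := Finset.mem_range.1 hd
      simp only [wal_add_div hb _ hd' hx', map_mul]
      ring
    rw [← intervalIntegral.integral_const_mul, ← h2, h1, Complex.real_smul, Complex.ofReal_natCast,
      inv_mul_cancel_left₀ hbc]
  rw [Finset.sum_congr rfl hpiece, ← Finset.mul_sum, ← Finset.sum_mul,
    sum_exp_digit hb (Nat.mod_lt _ (by omega)) (Nat.mod_lt _ (by omega)), ← mul_assoc]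
  congr 1
  split_ifs <;> simp [hbc]

lemma integral_wal_mul_conj {b : ℕ} (hb : 1 < b) (k k' : ℕ) :
    ∫ x in (0 : ℝ)..1, wal b k x * (starRingEnd ℂ) (wal b k' x) = if k = k' then 1 else 0 := by
  induction hm : max k k' using Nat.strong_induction_on generalizing k k' with
  | _ m ih =>
    rcases Nat.eq_zero_or_pos m with h0 | hpos
    · obtain ⟨rfl, rfl⟩ : k = 0 ∧ k' = 0 := by omega
      simp [wal]
    -- Stripping the lowest digits decreases the larger index; equality of the remainders and of the
    -- quotients is then equality of the indices.
    · have hlt : max (k / b) (k' / b) < m := by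
        have h1 : ∀ a, a ≤ m → a / b < m := fun a ha => by
          rcases Nat.eq_zero_or_pos a with rfl | h
          · simpa using hpos
          · exact (Nat.div_lt_self h hb).trans_le ha
        exact max_lt (h1 _ (by omega)) (h1 _ (by omega))
      rw [integral_wal_mul_conj_eq_mul hb, ih _ hlt _ _ rfl]
      by_cases h : k = k'
      · simp [h]
      · rw [if_neg h]
        by_cases h1 : k % b = k' % b
        · rw [if_pos h1, if_neg, mul_zero]
          intro h2
          exact h (by rw [← Nat.div_add_mod k b, ← Nat.div_add_mod k' b, h1, h2])
        · rw [if_neg h1, zero_mul]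

/-! ### Orthonormality of the products -/

lemma integral_exp_mul_conj (l l' : ℤ) :
    ∫ y in (0 : ℝ)..1, Complex.exp (2 * Real.pi * Complex.I * ((l : ℂ) * (y : ℂ))) *
      (starRingEnd ℂ) (Complex.exp (2 * Real.pi * Complex.I * ((l' : ℂ) * (y : ℂ)))) =
      if l = l' then 1 else 0 := by
  have h1 : ∀ y : ℝ, Complex.exp (2 * Real.pi * Complex.I * ((l : ℂ) * (y : ℂ))) *
      (starRingEnd ℂ) (Complex.exp (2 * Real.pi * Complex.I * ((l' : ℂ) * (y : ℂ)))) =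
      Complex.exp ((2 * Real.pi * Complex.I * ((l - l' : ℤ) : ℂ)) * (y : ℂ)) := fun y => by
    rw [← Complex.exp_conj, ← Complex.exp_add]
    congr 1
    simp only [map_mul, map_ofNat, Complex.conj_ofReal, Complex.conj_I, map_intCast, Int.cast_sub]
    ring
  simp_rw [h1]
  split_ifs with h
  · simp [h]
  · have hne : (2 * Real.pi * Complex.I * ((l - l' : ℤ) : ℂ)) ≠ 0 :=
      mul_ne_zero Complex.two_pi_I_ne_zero (Int.cast_ne_zero.2 (sub_ne_zero.2 h))
    rw [integral_exp_mul_complex hne]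
    have h2 : Complex.exp (2 * Real.pi * Complex.I * ((l - l' : ℤ) : ℂ)) = 1 :=
      Complex.exp_eq_one_iff.2 ⟨l - l', by ring⟩
    rw [Complex.ofReal_one, mul_one, h2]
    simp

lemma integral_comap_coe_Ico (f : ℝ → ℂ) :
    ∫ x : Set.Ico (0 : ℝ) 1, f x ∂(Measure.comap Subtype.val volume) = ∫ x in (0 : ℝ)..1, f x := by
  rw [integral_subtype_comap measurableSet_Ico, integral_Ico_eq_integral_Ioc,
    intervalIntegral.integral_of_le zero_le_one]

instance isProbabilityMeasure_comap_coe_Ico : IsProbabilityMeasure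
    (Measure.comap (Subtype.val : Set.Ico (0 : ℝ) 1 → ℝ) volume) := by
  constructor
  rw [(MeasurableEmbedding.subtype_coe measurableSet_Ico).comap_apply, Set.image_univ,
    Subtype.range_coe, Real.volume_Ico]
  simp

instance isProbabilityMeasure_cubeMeasure (s t : ℕ) : IsProbabilityMeasure (cubeMeasure s t) := by
  unfold cubeMeasure
  infer_instance

lemma basisFun_eq_prod (b : ℕ) {s t : ℕ} (h : Freq s t) (z : Cube s t) :
    basisFun b h z = (∏ j, wal b (h.1 j) (z.1 j : ℝ)) *
      ∏ j, Complex.exp (2 * Real.pi * Complex.I * ((h.2 j : ℂ) * ((z.2 j : ℝ) : ℂ))) := by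
  rw [basisFun, ← Complex.exp_sum, ← Finset.mul_sum]
  push_cast
  rfl

lemma integral_basisFun_mul_conj {b : ℕ} (hb : 1 < b) {s t : ℕ} (h h' : Freq s t) :
    ∫ z, basisFun b h z * (starRingEnd ℂ) (basisFun b h' z) ∂(cubeMeasure s t) =
      (∏ j, if h.1 j = h'.1 j then 1 else 0) * ∏ j, if h.2 j = h'.2 j then 1 else 0 := by
  have h1 : ∀ z : Cube s t, basisFun b h z * (starRingEnd ℂ) (basisFun b h' z) =
      (∏ j, wal b (h.1 j) (z.1 j : ℝ) * (starRingEnd ℂ) (wal b (h'.1 j) (z.1 j : ℝ))) *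
      ∏ j, Complex.exp (2 * Real.pi * Complex.I * ((h.2 j : ℂ) * ((z.2 j : ℝ) : ℂ))) *
        (starRingEnd ℂ)
          (Complex.exp (2 * Real.pi * Complex.I * ((h'.2 j : ℂ) * ((z.2 j : ℝ) : ℂ)))) := fun z => by
    rw [basisFun_eq_prod, basisFun_eq_prod, map_mul, map_prod, map_prod, Finset.prod_mul_distrib,
      Finset.prod_mul_distrib]
    ring
  simp_rw [h1]
  rw [cubeMeasure, integral_prod_mul
    (f := fun x : Fin s → Set.Ico (0 : ℝ) 1 =>
      ∏ j, wal b (h.1 j) (x j : ℝ) * (starRingEnd ℂ) (wal b (h'.1 j) (x j : ℝ)))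
    (g := fun y : Fin t → Set.Ico (0 : ℝ) 1 =>
      ∏ j, Complex.exp (2 * Real.pi * Complex.I * ((h.2 j : ℂ) * ((y j : ℝ) : ℂ))) *
        (starRingEnd ℂ)
          (Complex.exp (2 * Real.pi * Complex.I * ((h'.2 j : ℂ) * ((y j : ℝ) : ℂ)))))]
  congr 1
  · rw [integral_fintype_prod_eq_prod (f := fun (j : Fin s) (x : Set.Ico (0 : ℝ) 1) =>
      wal b (h.1 j) (x : ℝ) * (starRingEnd ℂ) (wal b (h'.1 j) (x : ℝ)))]
    exact Finset.prod_congr rfl fun j _ => by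
      rw [integral_comap_coe_Ico fun x => wal b (h.1 j) x * (starRingEnd ℂ) (wal b (h'.1 j) x),
        integral_wal_mul_conj hb]
  · rw [integral_fintype_prod_eq_prod (f := fun (j : Fin t) (y : Set.Ico (0 : ℝ) 1) =>
      Complex.exp (2 * Real.pi * Complex.I * ((h.2 j : ℂ) * ((y : ℝ) : ℂ))) * (starRingEnd ℂ)
          (Complex.exp (2 * Real.pi * Complex.I * ((h'.2 j : ℂ) * ((y : ℝ) : ℂ)))))]
    exact Finset.prod_congr rfl fun j _ => by
      rw [integral_comap_coe_Ico fun y => Complex.exp (2 * Real.pi * Complex.I *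
        ((h.2 j : ℂ) * (y : ℂ))) * (starRingEnd ℂ)
          (Complex.exp (2 * Real.pi * Complex.I * ((h'.2 j : ℂ) * (y : ℂ)))),
        integral_exp_mul_conj]

lemma unimodularSystem_basisFun {b : ℕ} (hb : 1 < b) (s t : ℕ) :
    UnimodularSystem (cubeMeasure s t) (basisFun b : Freq s t → Cube s t → ℂ) where
  measurable h := by
    have h1 : ∀ j, Measurable fun z : Cube s t => wal b (h.1 j) (z.1 j : ℝ) := fun j =>
      (measurable_wal b _).comp (by fun_prop)
    unfold basisFun
    refine (Finset.measurable_prod _ fun j _ => h1 j).mul ?_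
    fun_prop
  norm_eq_one h z := by
    rw [basisFun, norm_mul, norm_prod, Complex.norm_exp]
    simp [norm_wal]
  integral_mul_conj h := by
    rw [integral_basisFun_mul_conj hb]
    simp
  integral_mul_conj_of_ne h h' hne := by
    rw [integral_basisFun_mul_conj hb]
    by_contra h0
    obtain ⟨h1, h2⟩ := mul_ne_zero_iff.1 h0
    refine hne (Prod.ext (funext fun j => ?_) (funext fun j => ?_))
    · by_contra hj
      exact Finset.prod_ne_zero_iff.1 h1 j (Finset.mem_univ _) (if_neg hj)
    · by_contra hj
      exact Finset.prod_ne_zero_iff.1 h2 j (Finset.mem_univ _) (if_neg hj)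

/-! ### The trace of the decay functions -/

/-- Both `rho` and `rKor` unfold to this shape, so it bounds every one-dimensional factor of the
trace. -/
lemma sum_ite_one_le {κ : Type*} [DecidableEq κ] {u : κ → ℝ} (hu : ∀ k, 0 ≤ u k)
    (hs : Summable u) {γ : ℝ} (hγ : 0 ≤ γ) (z : κ) (F : Finset κ) :
    ∑ k ∈ F, (if k = z then 1 else γ * u k) ≤ 1 + γ * ∑' k, u k := by
  calc ∑ k ∈ F, (if k = z then 1 else γ * u k)
      ≤ ∑ k ∈ F, ((if k = z then 1 else 0) + γ * u k) := by
        refine Finset.sum_le_sum fun k _ => ?_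
        have := mul_nonneg hγ (hu k)
        split_ifs <;> linarith
    _ = (∑ k ∈ F, if k = z then (1 : ℝ) else 0) + γ * ∑ k ∈ F, u k := by
        rw [Finset.sum_add_distrib, Finset.mul_sum]
    _ ≤ 1 + γ * ∑' k, u k := by
        gcongr
        · rw [Finset.sum_ite_eq']
          split_ifs <;> norm_num
        · exact hs.sum_le_tsum F fun k _ => hu k

lemma summable_rpow_neg_log {b : ℕ} (hb : 1 < b) {α : ℝ} (hα : 1 < α) :
    Summable fun k : ℕ => (b : ℝ) ^ (-(α * (Nat.log b k : ℝ))) := by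
  have hb0 : (0 : ℝ) < b := by positivity
  -- The index `0` is removed because the comparison with `b ^ α * k ^ (-α)` fails there: `0 ^ (-α)`
  -- is `0`, while the term is `1`.
  rw [← summable_nat_add_iff 1]
  have h1 : Summable fun k : ℕ => (b : ℝ) ^ α * ((k + 1 : ℕ) : ℝ) ^ (-α) :=
    ((summable_nat_add_iff 1).2 (Real.summable_nat_rpow.2 (by linarith))).mul_left _
  refine Summable.of_nonneg_of_le (fun k => by positivity) (fun k => ?_) h1
  have hk : ((k + 1 : ℕ) : ℝ) ≤ (b : ℝ) ^ ((Nat.log b (k + 1) : ℝ) + 1) := by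
    have := (Nat.lt_pow_succ_log_self hb (k + 1)).le
    have h2 : ((k + 1 : ℕ) : ℝ) ≤ ((b ^ (Nat.log b (k + 1) + 1) : ℕ) : ℝ) := by exact_mod_cast this
    rw [Nat.cast_pow, ← Real.rpow_natCast] at h2
    simpa using h2
  have hk0 : (0 : ℝ) < ((k + 1 : ℕ) : ℝ) := by positivity
  calc (b : ℝ) ^ (-(α * (Nat.log b (k + 1) : ℝ)))
      = (b : ℝ) ^ α * ((b : ℝ) ^ ((Nat.log b (k + 1) : ℝ) + 1)) ^ (-α) := by
        rw [← Real.rpow_mul hb0.le, ← Real.rpow_add hb0]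
        congr 1
        ring
    _ ≤ (b : ℝ) ^ α * ((k + 1 : ℕ) : ℝ) ^ (-α) := by
        gcongr ?_ * ?_
        exact Real.rpow_le_rpow_of_nonpos hk0 hk (by linarith)

lemma rho_pos {b : ℕ} (hb : 1 < b) (α : ℝ) {γ : ℝ} (hγ : 0 < γ) (k : ℕ) : 0 < rho b α γ k := by
  unfold rho
  split_ifs
  · exact one_pos
  · have : (0 : ℝ) < b := by positivity
    positivity

lemma rKor_pos (β : ℝ) {γ : ℝ} (hγ : 0 < γ) (l : ℤ) : 0 < rKor β γ l := by
  unfold rKor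
  split_ifs with hl
  · exact one_pos
  · have : (0 : ℝ) < |(l : ℝ)| := abs_pos.2 (Int.cast_ne_zero.2 hl)
    positivity

/-- Enlarge `F` to the box of its coordinate projections; the sum over a box is a product of sums.
-/
lemma sum_prod_le {κ : Type*} {n : ℕ} {p : Fin n → κ → ℝ} (hp : ∀ j k, 0 ≤ p j k) {m : Fin n → ℝ}
    (hm : ∀ j (F : Finset κ), ∑ k ∈ F, p j k ≤ m j) (F : Finset (Fin n → κ)) :
    ∑ h ∈ F, ∏ j, p j (h j) ≤ ∏ j, m j := by
  classical
  calc ∑ h ∈ F, ∏ j, p j (h j)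
      ≤ ∑ h ∈ Fintype.piFinset fun j => F.image fun h => h j, ∏ j, p j (h j) := by
        refine Finset.sum_le_sum_of_subset_of_nonneg (fun h hh => ?_)
          fun h _ _ => Finset.prod_nonneg fun j _ => hp j _
        exact Fintype.mem_piFinset.2 fun j => Finset.mem_image_of_mem _ hh
    _ = ∏ j, ∑ k ∈ F.image fun h => h j, p j k := (Finset.prod_univ_sum _ _).symm
    _ ≤ ∏ j, m j :=
        Finset.prod_le_prod (fun j _ => Finset.sum_nonneg fun k _ => hp j k) fun j _ => hm j _

lemma prod_one_add_mul_le_exp {γ : ℕ → ℝ} (hγ : ∀ j, 0 ≤ γ j) {c : ℝ} (hc : 0 ≤ c) (n : ℕ) :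
    ∏ j : Fin n, (1 + γ j * c) ≤ Real.exp (c * ∑ j ∈ Finset.range n, γ j) := by
  rw [Finset.mul_sum, Real.exp_sum, Finset.prod_range]
  refine Finset.prod_le_prod (fun j _ => ?_) fun j _ => ?_
  · have := mul_nonneg (hγ j) hc
    linarith
  · have := Real.add_one_le_exp (c * γ j)
    linarith

section Weights

variable {b : ℕ} {α β : ℝ} {γ₁ γ₂ : ℕ → ℝ}

lemma decay_pos (hb : 1 < b) (hγ₁ : ∀ j, 0 < γ₁ j) (hγ₂ : ∀ j, 0 < γ₂ j) {s t : ℕ}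
    (h : Freq s t) : 0 < decay b α β γ₁ γ₂ h :=
  mul_pos (Finset.prod_pos fun j _ => rho_pos hb α (hγ₁ j) _)
    (Finset.prod_pos fun j _ => rKor_pos β (hγ₂ j) _)

/-- The trace factorises over the coordinates, and `1 + x ≤ exp x` turns the product into a sum of
weights. What matters is that `c` does not depend on `s` and `t`. -/
lemma exists_tsum_decay_le (hb : 1 < b) (hα : 1 < α) (hβ : 1 < β) (hγ₁ : ∀ j, 0 < γ₁ j)
    (hγ₂ : ∀ j, 0 < γ₂ j) :
    ∃ c : ℝ, 0 ≤ c ∧ ∀ s t : ℕ, Summable (decay b α β γ₁ γ₂ : Freq s t → ℝ) ∧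
      ∑' h : Freq s t, decay b α β γ₁ γ₂ h ≤
        Real.exp (c * (∑ j ∈ Finset.range s, γ₁ j + ∑ j ∈ Finset.range t, γ₂ j)) := by
  classical
  set c₁ := ∑' k : ℕ, (b : ℝ) ^ (-(α * (Nat.log b k : ℝ)))
  set c₂ := ∑' l : ℤ, |(l : ℝ)| ^ (-β)
  have hc₁ : 0 ≤ c₁ := tsum_nonneg fun k => by positivity
  have hc₂ : 0 ≤ c₂ := tsum_nonneg fun l => by positivity
  refine ⟨max c₁ c₂, le_max_of_le_left hc₁, fun s t => ?_⟩
  have hpos : ∀ h : Freq s t, 0 ≤ decay b α β γ₁ γ₂ h := fun h => (decay_pos hb hγ₁ hγ₂ h).le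
  have hbound : ∀ F : Finset (Freq s t), ∑ h ∈ F, decay b α β γ₁ γ₂ h ≤
      Real.exp (max c₁ c₂ * (∑ j ∈ Finset.range s, γ₁ j + ∑ j ∈ Finset.range t, γ₂ j)) := by
    intro F
    have h1 : ∀ G : Finset (Fin s → ℕ), ∑ k ∈ G, ∏ j : Fin s, rho b α (γ₁ j) (k j) ≤
        Real.exp (max c₁ c₂ * ∑ j ∈ Finset.range s, γ₁ j) := fun G => by
      refine (sum_prod_le (fun j k => (rho_pos hb α (hγ₁ j) k).le) (m := fun j => 1 + γ₁ j * c₁)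
        (fun j G' => ?_) G).trans ((prod_one_add_mul_le_exp (fun j => (hγ₁ j).le) hc₁ s).trans ?_)
      · exact sum_ite_one_le (fun k => by positivity) (summable_rpow_neg_log hb hα) (hγ₁ j).le 0 G'
      · have := Finset.sum_nonneg fun j (_ : j ∈ Finset.range s) => (hγ₁ j).le
        gcongr
        exact le_max_left _ _
    have h2 : ∀ G : Finset (Fin t → ℤ), ∑ l ∈ G, ∏ j : Fin t, rKor β (γ₂ j) (l j) ≤
        Real.exp (max c₁ c₂ * ∑ j ∈ Finset.range t, γ₂ j) := fun G => by
      refine (sum_prod_le (fun j k => (rKor_pos β (hγ₂ j) k).le) (m := fun j => 1 + γ₂ j * c₂)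
        (fun j G' => ?_) G).trans ((prod_one_add_mul_le_exp (fun j => (hγ₂ j).le) hc₂ t).trans ?_)
      · exact sum_ite_one_le (fun k => by positivity) (Real.summable_abs_int_rpow hβ) (hγ₂ j).le 0 G'
      · have := Finset.sum_nonneg fun j (_ : j ∈ Finset.range t) => (hγ₂ j).le
        gcongr
        exact le_max_right _ _
    calc ∑ h ∈ F, decay b α β γ₁ γ₂ h
        ≤ ∑ h ∈ F.image Prod.fst ×ˢ F.image Prod.snd, decay b α β γ₁ γ₂ h :=
          Finset.sum_le_sum_of_subset_of_nonneg Finset.subset_product fun h _ _ => hpos h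
      _ = (∑ k ∈ F.image Prod.fst, ∏ j : Fin s, rho b α (γ₁ j) (k j)) *
            ∑ l ∈ F.image Prod.snd, ∏ j : Fin t, rKor β (γ₂ j) (l j) := by
          rw [Finset.sum_mul_sum, Finset.sum_product]
          rfl
      _ ≤ Real.exp (max c₁ c₂ * ∑ j ∈ Finset.range s, γ₁ j) *
            Real.exp (max c₁ c₂ * ∑ j ∈ Finset.range t, γ₂ j) := by
          refine mul_le_mul (h1 _) (h2 _) (Finset.sum_nonneg fun l _ =>
            Finset.prod_nonneg fun j _ => (rKor_pos β (hγ₂ j) _).le) (Real.exp_nonneg _)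
      _ = _ := by rw [← Real.exp_add, mul_add]
  have hs := summable_of_sum_le hpos hbound
  exact ⟨hs, hs.tsum_le_of_sum_le hbound⟩

/-! ### The information complexity -/

lemma infoComplexity_le (hb : 1 < b) (hγ₁ : ∀ j, 0 < γ₁ j) (hγ₂ : ∀ j, 0 < γ₂ j) {s t : ℕ}
    (hs : Summable (decay b α β γ₁ γ₂ : Freq s t → ℝ)) {ε : ℝ} (hε : 0 < ε) {n : ℕ}
    (hn : 4 * (∑' h : Freq s t, decay b α β γ₁ γ₂ h) ^ 2 * (ε ^ 4)⁻¹ ≤ n) :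
    infoComplexity b α β γ₁ γ₂ ε s t ≤ n := by
  obtain ⟨x, a, ha, hA⟩ := (unimodularSystem_basisFun hb s t).exists_approximation
    (fun h => decay_pos hb hγ₁ hγ₂ h) hs hε hn
  have herr : minimalError b α β γ₁ γ₂ n s t ≤ ENNReal.ofReal ε := ?_
  · exact iInf₂_le (f := fun (N : ℕ) (_ : minimalError b α β γ₁ γ₂ N s t ≤ ENNReal.ofReal ε) =>
      (N : ℕ∞)) n herr
  refine (iInf_le _ (⟨x, a, ha⟩ : StdAlgorithm n s t)).trans (iSup₂_le ?_)
  rintro f ⟨⟨-, hf, hsum⟩, hnorm⟩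
  refine hA f (coeff b f) hf fun F => ?_
  refine (hsum.sum_le_tsum F fun h _ => ?_).trans (Real.sqrt_le_one.1 hnorm)
  have := decay_pos (α := α) (β := β) hb hγ₁ hγ₂ h
  positivity

/-- The information complexity is at most of order `ε ^ (-4)` times the square of the trace. -/
theorem exists_infoComplexity_le (hb : 1 < b) (hα : 1 < α) (hβ : 1 < β) (hγ₁ : ∀ j, 0 < γ₁ j)
    (hγ₂ : ∀ j, 0 < γ₂ j) :
    ∃ c : ℝ, 0 ≤ c ∧ ∀ (s t : ℕ) (ε : ℝ), 0 < ε → ε < 1 → ∃ n : ℕ,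
      infoComplexity b α β γ₁ γ₂ ε s t ≤ n ∧
      (n : ℝ) ≤ 5 * Real.exp (c * (∑ j ∈ Finset.range s, γ₁ j + ∑ j ∈ Finset.range t, γ₂ j)) *
        (ε ^ 4)⁻¹ := by
  obtain ⟨c, hc, h⟩ := exists_tsum_decay_le hb hα hβ hγ₁ hγ₂
  refine ⟨2 * c, by positivity, fun s t ε hε hε1 => ?_⟩
  obtain ⟨hs, hle⟩ := h s t
  refine ⟨_, infoComplexity_le hb hγ₁ hγ₂ hs hε (Nat.le_ceil _), ?_⟩
  set σ := ∑ j ∈ Finset.range s, γ₁ j + ∑ j ∈ Finset.range t, γ₂ j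
  have hσ : 0 ≤ σ := add_nonneg (Finset.sum_nonneg fun j _ => (hγ₁ j).le)
    (Finset.sum_nonneg fun j _ => (hγ₂ j).le)
  have hT0 : 0 ≤ ∑' h : Freq s t, decay b α β γ₁ γ₂ h :=
    tsum_nonneg fun h => (decay_pos hb hγ₁ hγ₂ h).le
  have hexp : Real.exp (2 * c * σ) = Real.exp (c * σ) ^ 2 := by
    rw [← Real.exp_nat_mul]
    congr 1
    push_cast
    ring
  have h1 : 1 ≤ Real.exp (2 * c * σ) := Real.one_le_exp (by positivity)
  have h2 : 1 ≤ (ε ^ 4)⁻¹ := (one_le_inv₀ (by positivity)).2 (pow_le_one₀ hε.le hε1.le)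
  have h3 : (∑' h : Freq s t, decay b α β γ₁ γ₂ h) ^ 2 ≤ Real.exp (2 * c * σ) := by
    rw [hexp]
    gcongr
  -- Rounding up adds at most `1`, which is absorbed by enlarging the factor `4` to `5`.
  refine (Nat.ceil_lt_add_one (by positivity)).le.trans ?_
  calc 4 * (∑' h : Freq s t, decay b α β γ₁ γ₂ h) ^ 2 * (ε ^ 4)⁻¹ + 1
      ≤ 4 * Real.exp (2 * c * σ) * (ε ^ 4)⁻¹ + Real.exp (2 * c * σ) * (ε ^ 4)⁻¹ := by
        gcongr
        exact one_le_mul_of_one_le_of_one_le h1 h2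
    _ = _ := by ring

/-! ### Tractability -/

/-- For summable weights the trace is bounded, so that the exponent `4` is admissible. -/
lemma strongPolyBound_four (hb : 1 < b) (hα : 1 < α) (hβ : 1 < β) (hγ₁ : ∀ j, 0 < γ₁ j)
    (hγ₂ : ∀ j, 0 < γ₂ j) (h₁ : Summable γ₁) (h₂ : Summable γ₂) :
    StrongPolyBound b α β γ₁ γ₂ 4 := by
  obtain ⟨c, hc, h⟩ := exists_infoComplexity_le hb hα hβ hγ₁ hγ₂
  refine ⟨NNReal.mk (5 * Real.exp (c * (∑' j, γ₁ j + ∑' j, γ₂ j))) (by positivity),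
    fun ε hε hε1 s t _ _ => ?_⟩
  obtain ⟨n, hn, hle⟩ := h s t ε hε hε1
  refine (ENat.toENNReal_le.2 hn).trans ?_
  rw [ENat.toENNReal_coe, ← ENNReal.ofReal_natCast]
  refine ENNReal.ofReal_le_ofReal (hle.trans ?_)
  have h4 : ε ^ (-((4 : ℝ≥0) : ℝ)) = (ε ^ 4)⁻¹ := by
    rw [Real.rpow_neg hε.le, NNReal.coe_ofNat, Real.rpow_ofNat]
  rw [h4, NNReal.coe_mk]
  gcongr
  · exact h₁.sum_le_tsum _ fun j _ => (hγ₁ j).le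
  · exact h₂.sum_le_tsum _ fun j _ => (hγ₂ j).le

/-- The limsup controls only large `s`; the finitely many earlier quotients are absorbed by adding
all their absolute values to the constant. -/
lemma exists_sum_le_mul_log {γ : ℕ → ℝ}
    (h : limsup (fun s : ℕ =>
      (((∑ j ∈ Finset.range s, γ j / Real.log ((s : ℝ) + 1)) : ℝ) : EReal)) atTop < ⊤) :
    ∃ M : ℝ, 0 ≤ M ∧ ∀ s : ℕ, 1 ≤ s →
      ∑ j ∈ Finset.range s, γ j ≤ M * Real.log ((s : ℝ) + 1) := by
  obtain ⟨M, hM, -⟩ := EReal.lt_iff_exists_real_btwn.1 h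
  obtain ⟨s₀, hs₀⟩ := eventually_atTop.1 (eventually_lt_of_limsup_lt hM)
  set q : ℕ → ℝ := fun s => ∑ j ∈ Finset.range s, γ j / Real.log ((s : ℝ) + 1) with hq
  have hsum0 : 0 ≤ ∑ s ∈ Finset.range s₀, |q s| := Finset.sum_nonneg fun _ _ => abs_nonneg _
  refine ⟨|M| + ∑ s ∈ Finset.range s₀, |q s|, by positivity, fun s hs => ?_⟩
  have hlog : 0 < Real.log ((s : ℝ) + 1) := Real.log_pos (by
    have : (1 : ℝ) ≤ s := by exact_mod_cast hs
    linarith)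
  rw [← div_le_iff₀ hlog, Finset.sum_div]
  change q s ≤ _
  rcases le_or_gt s₀ s with h1 | h1
  · have : q s < M := EReal.coe_lt_coe_iff.1 (hs₀ s h1)
    linarith [le_abs_self M]
  · have := Finset.single_le_sum (f := fun s => |q s|) (fun _ _ => abs_nonneg _)
      (Finset.mem_range.2 h1)
    linarith [le_abs_self (q s), abs_nonneg M]

lemma polynomiallyTractable_of_sum_le (hb : 1 < b) (hα : 1 < α) (hβ : 1 < β)
    (hγ₁ : ∀ j, 0 < γ₁ j) (hγ₂ : ∀ j, 0 < γ₂ j) {M₁ M₂ : ℝ} (hM₁ : 0 ≤ M₁) (hM₂ : 0 ≤ M₂)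
    (h₁ : ∀ s : ℕ, 1 ≤ s → ∑ j ∈ Finset.range s, γ₁ j ≤ M₁ * Real.log ((s : ℝ) + 1))
    (h₂ : ∀ t : ℕ, 1 ≤ t → ∑ j ∈ Finset.range t, γ₂ j ≤ M₂ * Real.log ((t : ℝ) + 1)) :
    PolynomiallyTractable b α β γ₁ γ₂ := by
  obtain ⟨c, hc, h⟩ := exists_infoComplexity_le hb hα hβ hγ₁ hγ₂
  refine ⟨5, 4, NNReal.mk (c * (M₁ + M₂)) (by positivity), fun ε hε hε1 s t hs ht => ?_⟩
  obtain ⟨n, hn, hle⟩ := h s t ε hε hε1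
  refine (ENat.toENNReal_le.2 hn).trans ?_
  rw [ENat.toENNReal_coe, ← ENNReal.ofReal_natCast]
  refine ENNReal.ofReal_le_ofReal (hle.trans ?_)
  have h4 : ε ^ (-((4 : ℝ≥0) : ℝ)) = (ε ^ 4)⁻¹ := by
    rw [Real.rpow_neg hε.le, NNReal.coe_ofNat, Real.rpow_ofNat]
  have hs' : (1 : ℝ) ≤ s := by exact_mod_cast hs
  have ht' : (1 : ℝ) ≤ t := by exact_mod_cast ht
  rw [h4, NNReal.coe_mk, mul_right_comm, NNReal.coe_ofNat, Real.rpow_def_of_pos (by linarith)]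
  refine mul_le_mul_of_nonneg_left (Real.exp_le_exp.2 ?_) (by positivity)
  -- As `s, t ≥ 1`, both `s + 1` and `t + 1` are at most `s + t`; the exponential then becomes the
  -- power `(s + t) ^ (c * (M₁ + M₂))`.
  have h5 := (h₁ s hs).trans (mul_le_mul_of_nonneg_left
    (Real.log_le_log (by linarith) (by linarith : (s : ℝ) + 1 ≤ s + t)) hM₁)
  have h6 := (h₂ t ht).trans (mul_le_mul_of_nonneg_left
    (Real.log_le_log (by linarith) (by linarith : (t : ℝ) + 1 ≤ s + t)) hM₂)
  calc c * (∑ j ∈ Finset.range s, γ₁ j + ∑ j ∈ Finset.range t, γ₂ j)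
      ≤ c * (M₁ * Real.log (s + t) + M₂ * Real.log (s + t)) := by gcongr
    _ = _ := by ring

/-- The logarithm grows more slowly than any linear function, with an explicit constant; it is
applied to `u = ε⁻¹`. -/
lemma log_le_mul_add {η u : ℝ} (hη : 0 < η) (hu : 0 < u) :
    Real.log u ≤ η * u + |Real.log η| := by
  have h1 := Real.log_le_sub_one_of_pos (mul_pos hη hu)
  rw [Real.log_mul hη.ne' hu.ne'] at h1
  linarith [neg_abs_le (Real.log η)]

lemma weaklyTractable_of_tendsto (hb : 1 < b) (hα : 1 < α) (hβ : 1 < β)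
    (hγ₁ : ∀ j, 0 < γ₁ j ∧ γ₁ j ≤ 1) (hγ₂ : ∀ j, 0 < γ₂ j ∧ γ₂ j ≤ 1)
    (hlim : Tendsto (fun p : ℕ × ℕ =>
        (∑ j ∈ Finset.range p.1, γ₁ j + ∑ j ∈ Finset.range p.2, γ₂ j) /
          ((p.1 : ℝ) + (p.2 : ℝ)))
        (comap (fun p : ℕ × ℕ => p.1 + p.2) atTop ⊓ 𝓟 {p | 1 ≤ p.1 ∧ 1 ≤ p.2}) (𝓝 0)) :
    WeaklyTractable b α β γ₁ γ₂ := by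
  obtain ⟨c, hc, h⟩ := exists_infoComplexity_le hb hα hβ (fun j => (hγ₁ j).1) fun j => (hγ₂ j).1
  refine ⟨fun s t _ _ ε hε hε1 => ?_, ?_⟩
  · obtain ⟨n, hn, -⟩ := h s t ε hε hε1
    exact ne_top_of_le_ne_top (ENat.natCast_ne_top n) hn
  rw [Metric.tendsto_nhds]
  intro δ hδ
  -- With this slope, the linear parts of `c * (∑ γ₁ + ∑ γ₂)` and `4 * log ε⁻¹` together use at most
  -- half of `δ`.
  set η := δ / (2 * (c + 4)) with hη
  have hη0 : 0 < η := by positivity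
  have hsum : ∃ M : ℝ, 0 ≤ M ∧ ∀ s t : ℕ, 1 ≤ s → 1 ≤ t →
      ∑ j ∈ Finset.range s, γ₁ j + ∑ j ∈ Finset.range t, γ₂ j ≤ M + η * ((s : ℝ) + t) := by
    have h1 := hlim.eventually_lt_const hη0
    rw [eventually_inf_principal, eventually_comap] at h1
    obtain ⟨m, hm⟩ := eventually_atTop.1 h1
    -- Below the threshold, the weights being at most `1` bounds the sums by `s + t < m`.
    refine ⟨m, by positivity, fun s t hs ht => ?_⟩
    have hpos : (0 : ℝ) < (s : ℝ) + t := by positivity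
    rcases le_or_gt m (s + t) with h2 | h2
    · have h3 := hm _ h2 (s, t) rfl ⟨hs, ht⟩
      rw [div_lt_iff₀ hpos] at h3
      have : (0 : ℝ) ≤ m := by positivity
      simp only at h3
      linarith
    · have h3 : ∑ j ∈ Finset.range s, γ₁ j ≤ s := by
        simpa using Finset.sum_le_sum fun j (_ : j ∈ Finset.range s) => (hγ₁ j).2
      have h4 : ∑ j ∈ Finset.range t, γ₂ j ≤ t := by
        simpa using Finset.sum_le_sum fun j (_ : j ∈ Finset.range t) => (hγ₂ j).2
      have h5 : (s : ℝ) + t < m := by exact_mod_cast h2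
      have := mul_pos hη0 hpos
      linarith
  obtain ⟨M, hM, hsum⟩ := hsum
  set K := Real.log 5 + c * M + 4 * |Real.log η| with hK
  rw [eventually_inf_principal]
  -- Beyond `2 * K / δ` the constant `K` takes less than the other half of `δ`.
  filter_upwards [tendsto_comap.eventually_gt_atTop (2 * K / δ)]
  rintro ⟨s, t, ε⟩ hQ ⟨hs, ht, hε, hε1⟩
  simp only at hQ hs ht hε hε1 ⊢
  have hQ0 : 0 < (s : ℝ) + t + ε⁻¹ := by positivity
  obtain ⟨n, hn, hle⟩ := h s t ε hε hε1
  set N := (infoComplexity b α β γ₁ γ₂ ε s t).toNat with hN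
  have hNn : (N : ℝ) ≤ n := by
    exact_mod_cast ENat.toNat_le_of_le_natCast hn
  have hσ : 0 ≤ ∑ j ∈ Finset.range s, γ₁ j + ∑ j ∈ Finset.range t, γ₂ j :=
    add_nonneg (Finset.sum_nonneg fun j _ => (hγ₁ j).1.le)
      (Finset.sum_nonneg fun j _ => (hγ₂ j).1.le)
  have hlog : Real.log N ≤ Real.log 5 +
      c * (∑ j ∈ Finset.range s, γ₁ j + ∑ j ∈ Finset.range t, γ₂ j) + 4 * Real.log ε⁻¹ := by
    have h5 : (0 : ℝ) ≤ Real.log 5 := Real.log_nonneg (by norm_num)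
    have h6 : 0 ≤ Real.log ε⁻¹ := Real.log_nonneg ((one_le_inv₀ hε).2 hε1.le)
    rcases Nat.eq_zero_or_pos N with h0 | h0
    · rw [h0, Nat.cast_zero, Real.log_zero]
      positivity
    · refine (Real.log_le_log (by exact_mod_cast h0) (hNn.trans hle)).trans_eq ?_
      rw [Real.log_mul (by positivity) (by positivity), Real.log_mul (by norm_num)
        (Real.exp_ne_zero _), Real.log_exp, ← inv_pow, Real.log_pow]
      norm_num
  have hlt : Real.log N < δ * ((s : ℝ) + t + ε⁻¹) := by
    have h1 := mul_le_mul_of_nonneg_left (hsum s t hs ht) hc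
    have h2 := log_le_mul_add hη0 (inv_pos.2 hε)
    have h3 : K < δ / 2 * ((s : ℝ) + t + ε⁻¹) := by
      rw [div_lt_iff₀ hδ] at hQ
      linarith
    have h4 : (c + 4) * η = δ / 2 := by
      rw [hη]
      field_simp
    have h5 : c * (η * ((s : ℝ) + t)) + 4 * (η * ε⁻¹) ≤ δ / 2 * ((s : ℝ) + t + ε⁻¹) := by
      rw [← h4]
      have h6 : 0 ≤ c * (η * ε⁻¹) := by positivity
      have h7 : 0 ≤ 4 * (η * ((s : ℝ) + t)) := by positivity
      linarith
    linarith
  rw [Real.dist_0_eq_abs, abs_of_nonneg (div_nonneg (Real.log_natCast_nonneg _) hQ0.le),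
    div_lt_iff₀ hQ0]
  exact hlt

end Weights

end HybridApprox

theorem corollary1 (b : ℕ) (hb : b.Prime) (α β : ℝ) (hα : 1 < α) (hβ : 1 < β)
    (γ₁ γ₂ : ℕ → ℝ) (hγ₁ : Antitone γ₁) (hγ₂ : Antitone γ₂)
    (hγ₁_mem : ∀ j, 0 < γ₁ j ∧ γ₁ j ≤ 1) (hγ₂_mem : ∀ j, 0 < γ₂ j ∧ γ₂ j ≤ 1) :
    (Summable γ₁ → Summable γ₂ →
      HybridApprox.StronglyPolynomiallyTractable b α β γ₁ γ₂ ∧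
      HybridApprox.epsExponent b α β γ₁ γ₂ ≤
        4 + 2 * max (HybridApprox.sumExponent γ₁ γ₂)
          (max (ENNReal.ofReal (1 / α)) (ENNReal.ofReal (1 / β)))) ∧
    (limsup (fun s : ℕ =>
        (((∑ j ∈ Finset.range s, γ₁ j / Real.log ((s : ℝ) + 1)) : ℝ) : EReal)) atTop < ⊤ →
      limsup (fun t : ℕ =>
        (((∑ j ∈ Finset.range t, γ₂ j / Real.log ((t : ℝ) + 1)) : ℝ) : EReal)) atTop < ⊤ →
      HybridApprox.PolynomiallyTractable b α β γ₁ γ₂) ∧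
    (Tendsto (fun p : ℕ × ℕ =>
        (∑ j ∈ Finset.range p.1, γ₁ j + ∑ j ∈ Finset.range p.2, γ₂ j) /
          ((p.1 : ℝ) + (p.2 : ℝ)))
        (comap (fun p : ℕ × ℕ => p.1 + p.2) atTop ⊓ 𝓟 {p | 1 ≤ p.1 ∧ 1 ≤ p.2}) (𝓝 0) →
      HybridApprox.WeaklyTractable b α β γ₁ γ₂) := by
  have hb1 := hb.one_lt
  have hpos₁ : ∀ j, 0 < γ₁ j := fun j => (hγ₁_mem j).1
  have hpos₂ : ∀ j, 0 < γ₂ j := fun j => (hγ₂_mem j).1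
  refine ⟨fun h₁ h₂ => ?_, fun h₁ h₂ => ?_, fun h =>
    HybridApprox.weaklyTractable_of_tendsto hb1 hα hβ hγ₁_mem hγ₂_mem h⟩
  · have h4 := HybridApprox.strongPolyBound_four hb1 hα hβ hpos₁ hpos₂ h₁ h₂
    refine ⟨⟨4, h4⟩, (iInf₂_le (4 : ℝ≥0) h4).trans ?_⟩
    -- The exponent `4` is already admissible, and the term with the maximum is nonnegative.
    exact le_add_right (le_of_eq (by norm_num))
  · obtain ⟨M₁, hM₁, hle₁⟩ := HybridApprox.exists_sum_le_mul_log h₁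
    obtain ⟨M₂, hM₂, hle₂⟩ := HybridApprox.exists_sum_le_mul_log h₂
    exact HybridApprox.polynomiallyTractable_of_sum_le hb1 hα hβ hpos₁ hpos₂ hM₁ hM₂ hle₁ hle₂
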